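/- Let $K$ be a second-countable compact Hausdorff space and let $X$ be a right Hilbert $C(K)$-module. The canonical Hilbert bundle of $X$ is $p:\mathcal{E}=\bigsqcup_{x\in K}X/J_x\to K$, where $J_x=\{v\in X:\langle v,v\rangle(x)=0\}$, where the fibre $\mathcal{E}_x=X/J_x$ has the inner product $\langle v+J_x,w+J_x\rangle=\langle v,w\rangle(x)$, and where the topology is generated by the sets $\{b\in\mathcal{E}: p(b)\in U,\ \|b-(v+J_{p(b)})\|<\varepsilon\}$ for $v\in X$, $U\subseteq K$ open and $\varepsilon>0$. A compact topological graph $E$ consists of compact Hausdorff spaces $E^0,E^1$, a continuous map $r:E^1\to E^0$ and a local homeomorphism $s:E^1\to E^0$; its graph module is the Hilbert $C(E^0)$-module $X(E)=C(E^1)$ with $(\xi\cdot a)(e)=\xi(e)a(s(e))$ and $\langle\xi,\eta\rangle(v)=\sum_{s(e)=v}\overline{\xi(e)}\eta(e)$. The following are equivalent. 1. There are a compact topological graph $E$ and a homeomorphism $E^0\cong K$ such that $X$ is isomorphic, as a right Hilbert module, to $X(E)$ (where $C(E^0)$ and $C(K)$ are identified through the homeomorphism). 2. $X$ admits a continuous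 choice of finite orthonormal bases: there is a subset $B\subseteq\mathcal{E}$ such that $B\cap\mathcal{E}_x$ is a finite orthonormal basis of $\mathcal{E}_x$ for every $x\in K$, the restriction $p|_B:B\to K$ is a local homeomorphism, and the function $x\mapsto|B\cap\mathcal{E}_x|$ is locally constant. 3. The bundle $\mathcal{E}$ has finite rank (its fibres have finite, bounded dimension), and it admits a local trivialisation whose transition functions take values in the permutation matrices. That is, there are an open cover $(U_i)$ of $K$, integers $k(i)\ge 0$ and homeomorphisms $\psi_i:U_i\times\mathbb{C}^{k(i)}\to\mathcal{E}|_{U_i}$ over $U_i$, linear on each fibre, such that for all $i,j$ and all $x\in U_i\cap U_j$ there is a bijection $\sigma:\{1,\dots,k(i)\}\to\{1,\dots,k(j)\}$ with $\psi_j^{-1}\circ\psi_i(x,e_\ell)=(x,e_{\sigma(\ell)})$ for all $\ell\le k(i)$. 4. Condition 3 holds with maps $\psi_i$ that are moreover unitary on each fibre. -/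

import Mathlib

open scoped ComplexOrder

universe u v

/-! ## Isomorphisms of Hilbert modules -/

/-- An isomorphism between a Hilbert `C(K)`-module `X` and a Hilbert `C(L)`-module `Y`, where the
coefficient algebras are identified through a homeomorphism `h : L ≃ₜ K`, that is through
`C(K) ≅ C(L)`, `a ↦ a ∘ h`: a linear bijection that respects the module actions and the inner
products. -/
structure HilbertModuleIso {K L : Type*} [TopologicalSpace K] [TopologicalSpace L] (h : L ≃ₜ K)
    (X Y : Type*) [AddCommGroup X] [Module ℂ X] [SMul C(K, ℂ) X] [Inner C(K, ℂ) X]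
    [AddCommGroup Y] [Module ℂ Y] [SMul C(L, ℂ) Y] [Inner C(L, ℂ) Y] extends X ≃ₗ[ℂ] Y where
  map_action : ∀ (a : C(K, ℂ)) (x : X),
    toLinearEquiv (a • x) = a.comp (h : C(L, K)) • toLinearEquiv x
  map_inner : ∀ x y : X,
    inner C(L, ℂ) (toLinearEquiv x) (toLinearEquiv y) = (inner C(K, ℂ) x y).comp (h : C(L, K))

/-! ## Compact topological graphs and their graph modules -/

/-- A compact topological graph: compact Hausdorff spaces of vertices and of edges, a continuous
range map, and a source map that is a local homeomorphism. -/
structure CompactTopologicalGraph where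
  Vertex : Type u
  Edge : Type u
  [topVertex : TopologicalSpace Vertex]
  [topEdge : TopologicalSpace Edge]
  [compactVertex : CompactSpace Vertex]
  [compactEdge : CompactSpace Edge]
  [t2Vertex : T2Space Vertex]
  [t2Edge : T2Space Edge]
  range : Edge → Vertex
  source : Edge → Vertex
  continuous_range : Continuous range
  isLocalHomeomorph_source : IsLocalHomeomorph source

namespace CompactTopologicalGraph

attribute [instance] topVertex topEdge compactVertex compactEdge t2Vertex t2Edge

variable (E : CompactTopologicalGraph.{u})

theorem isCoveringMap_source : IsCoveringMap E.source :=
  isLocalHomeomorph_iff_isCoveringMap.mp E.isLocalHomeomorph_source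

/-- Only finitely many edges have a given source. -/
theorem finite_fiber (v : E.Vertex) : (E.source ⁻¹' {v}).Finite := by
  have hc : IsCompact (E.source ⁻¹' {v}) :=
    (isClosed_singleton.preimage E.isLocalHomeomorph_source.continuous).isCompact
  have hd : DiscreteTopology (E.source ⁻¹' {v}) :=
    (E.isCoveringMap_source v).discreteTopology_fiber
  exact hc.finite (isDiscrete_iff_discreteTopology.mpr hd)

/-- The sum `∑_{s(e) = v} f(e)`. -/
noncomputable def fiberSum (f : E.Edge → ℂ) (v : E.Vertex) : ℂ :=
  ∑ e ∈ (E.finite_fiber v).toFinset, f e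

theorem continuous_fiberSum {f : E.Edge → ℂ} (hf : Continuous f) :
    Continuous (E.fiberSum f) := by
  rw [continuous_iff_continuousAt]
  intro v
  have hcov := E.isCoveringMap_source v
  obtain ⟨-, U, hvU, hU, -, H, hH⟩ := hcov
  have hfin : Finite (E.source ⁻¹' {v}) := (E.finite_fiber v).to_subtype
  have : Fintype (E.source ⁻¹' {v}) := Fintype.ofFinite _
  have key : ∀ w : U, E.fiberSum f w = ∑ i : E.source ⁻¹' {v}, f (H.symm (w, i)) := by
    intro w
    symm
    unfold fiberSum
    refine Finset.sum_bij (fun i _ => ((H.symm (w, i) : E.source ⁻¹' U) : E.Edge)) ?_ ?_ ?_ ?_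
    · intro i _
      have := hH (H.symm (w, i))
      simp only [Homeomorph.apply_symm_apply] at this
      simp [← this]
    · intro i _ j _ hij
      have := H.symm.injective (Subtype.ext hij)
      exact (Prod.ext_iff.mp this).2
    · intro e he
      simp only [Set.Finite.mem_toFinset, Set.mem_preimage, Set.mem_singleton_iff] at he
      have heU : e ∈ E.source ⁻¹' U := by rw [Set.mem_preimage, he]; exact w.2
      refine ⟨(H ⟨e, heU⟩).2, Finset.mem_univ _, ?_⟩
      have h1 : (H ⟨e, heU⟩).1 = w := Subtype.ext ((hH ⟨e, heU⟩).trans he)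
      have h2 : (w, (H ⟨e, heU⟩).2) = H ⟨e, heU⟩ := Prod.ext h1.symm rfl
      rw [h2]; simp
    · intro i _; rfl
  have hcont : ContinuousOn (E.fiberSum f) U := by
    rw [continuousOn_iff_continuous_domRestrict]
    have : U.domRestrict (E.fiberSum f) =
        fun w : U => ∑ i : E.source ⁻¹' {v}, f (H.symm (w, i)) := funext key
    rw [this]
    refine continuous_finsetSum _ fun i _ => ?_
    exact hf.comp (continuous_subtype_val.comp
      (H.symm.continuous.comp (Continuous.prodMk continuous_id continuous_const)))
  exact hcont.continuousAt (hU.mem_nhds hvU)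

/-- The underlying space `C(E¹)` of the graph module of a compact topological graph. It carries
the norm given by the `C(E⁰)`-valued inner product, not the supremum norm. -/
def GraphModule : Type u := C(E.Edge, ℂ)

namespace GraphModule

noncomputable instance : AddCommGroup E.GraphModule := inferInstanceAs (AddCommGroup C(E.Edge, ℂ))

noncomputable instance : Module ℂ E.GraphModule := inferInstanceAs (Module ℂ C(E.Edge, ℂ))

variable {E}

/-- The continuous function on the edge space that an element of the graph module is. -/
def toMap (x : E.GraphModule) : C(E.Edge, ℂ) := x

/-- The right action `(x · a)(e) = x(e) a(s(e))`; as `C(E⁰)` is commutative, it is written on the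
left. -/
noncomputable instance : SMul C(E.Vertex, ℂ) E.GraphModule where
  smul a x := (x.toMap * a.comp ⟨E.source, E.isLocalHomeomorph_source.continuous⟩ : C(E.Edge, ℂ))

/-- The inner product `⟨x, y⟩(v) = ∑_{s(e) = v} conj x(e) * y(e)`. -/
noncomputable instance : Inner C(E.Vertex, ℂ) E.GraphModule where
  inner x y :=
    ⟨E.fiberSum fun e => star (x.toMap e) * y.toMap e,
      E.continuous_fiberSum (by fun_prop)⟩

theorem add_toMap (x y : E.GraphModule) (e : E.Edge) :
    (x + y).toMap e = x.toMap e + y.toMap e := rfl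

theorem smul_toMap (c : ℂ) (x : E.GraphModule) (e : E.Edge) :
    (c • x).toMap e = c * x.toMap e := rfl

theorem action_toMap (a : C(E.Vertex, ℂ)) (x : E.GraphModule) (e : E.Edge) :
    (a • x).toMap e = x.toMap e * a (E.source e) := rfl

theorem inner_apply (x y : E.GraphModule) (v : E.Vertex) :
    inner C(E.Vertex, ℂ) x y v =
      ∑ e ∈ (E.finite_fiber v).toFinset, star (x.toMap e) * y.toMap e := rfl

/-- The norm `‖x‖² = ‖⟨x, x⟩‖`. -/
noncomputable instance : Norm E.GraphModule := CStarModule.norm C(E.Vertex, ℂ)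

noncomputable instance : CStarModule C(E.Vertex, ℂ) E.GraphModule where
  inner_add_right {x y z} := by
    ext v
    simp [inner_apply, add_toMap, mul_add, Finset.sum_add_distrib]
  inner_self_nonneg {x} := by
    rw [ContinuousMap.le_def]
    intro v
    rw [inner_apply]
    exact Finset.sum_nonneg fun e _ => star_mul_self_nonneg _
  inner_self {x} := by
    constructor
    · intro h
      refine ContinuousMap.ext fun e => ?_
      have h1 := congrArg (fun g : C(E.Vertex, ℂ) => g (E.source e)) h
      simp only [inner_apply, ContinuousMap.zero_apply] at h1
      rw [Finset.sum_eq_zero_iff_of_nonneg fun e _ => star_mul_self_nonneg _] at h1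
      have h2 := h1 e (by simp)
      have h3 : x.toMap e = 0 := by simpa using h2
      exact h3
    · rintro rfl
      ext v
      rw [inner_apply]
      exact Finset.sum_eq_zero fun e _ => by
        have : (0 : E.GraphModule).toMap e = 0 := rfl
        simp [this]
  inner_op_smul_right {a x y} := by
    ext v
    simp only [inner_apply, action_toMap, ContinuousMap.mul_apply, Finset.mul_sum]
    refine Finset.sum_congr rfl fun e he => ?_
    have : E.source e = v := by simpa using he
    rw [this]; ring
  inner_smul_right_complex {z x y} := by
    ext v
    simp only [inner_apply, smul_toMap, ContinuousMap.smul_apply, smul_eq_mul, Finset.mul_sum]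
    exact Finset.sum_congr rfl fun e _ => by ring
  star_inner x y := by
    ext v
    simp [inner_apply, mul_comm]
  norm_eq_sqrt_norm_inner_self x := rfl

end GraphModule

end CompactTopologicalGraph

/-! ## The canonical Hilbert bundle of a Hilbert module over `C(K)` -/

namespace CanonicalBundle

/-- The module `X`, to be equipped with the positive semidefinite scalar product
`(v, w) ↦ ⟨v, w⟩(x)`. -/
def PreFiber {K : Type u} (X : Type v) (_x : K) : Type v := X

section

variable {K : Type u} [TopologicalSpace K] [CompactSpace K]
  (X : Type v) [NormedAddCommGroup X] [NormedSpace ℂ X] [Module C(K, ℂ) X]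
  [CStarModule C(K, ℂ) X] (x : K)

noncomputable instance : AddCommGroup (PreFiber X x) := inferInstanceAs (AddCommGroup X)

noncomputable instance : Module ℂ (PreFiber X x) := inferInstanceAs (Module ℂ X)

/-- The element of `X` that an element of `PreFiber X x` is. -/
def PreFiber.toModule {X : Type v} {x : K} (v : PreFiber X x) : X := v

/-- The scalar product `(v, w) ↦ ⟨v, w⟩(x)` on `X`. -/
noncomputable abbrev preFiberCore : PreInnerProductSpace.Core ℂ (PreFiber X x) where
  inner v w := (inner C(K, ℂ) v.toModule w.toModule) x
  conj_inner_symm v w :=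
    congrArg (fun g : C(K, ℂ) => g x)
      (CStarModule.star_inner (A := C(K, ℂ)) w.toModule v.toModule)
  re_inner_nonneg v := by
    have h : (0 : C(K, ℂ)) ≤ inner C(K, ℂ) v.toModule v.toModule :=
      CStarModule.inner_self_nonneg
    exact (Complex.le_def.mp (ContinuousMap.le_def.mp h x)).1
  add_left v w z :=
    congrArg (fun g : C(K, ℂ) => g x)
      (CStarModule.inner_add_left (A := C(K, ℂ))
        (x := v.toModule) (y := w.toModule) (z := z.toModule))
  smul_left v w r :=
    congrArg (fun g : C(K, ℂ) => g x)
      (CStarModule.inner_smul_left_complex (A := C(K, ℂ))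
        (z := r) (x := v.toModule) (y := w.toModule))

noncomputable instance : SeminormedAddCommGroup (PreFiber X x) :=
  @InnerProductSpace.Core.toSeminormedAddCommGroup ℂ _ _ _ _ (preFiberCore X x)

noncomputable instance : InnerProductSpace ℂ (PreFiber X x) :=
  InnerProductSpace.ofCore (preFiberCore X x)

/-- The fibre over `x`: the quotient of `X` by `J_x = {v | ⟨v, v⟩(x) = 0}`, with the inner product
that `⟨v, w⟩(x)` induces (`SeparationQuotient` divides out the vectors of seminorm zero). -/
abbrev Fiber : Type v := SeparationQuotient (PreFiber X x)

/-- The quotient map `X → X / J_x`. -/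
noncomputable def fiberMk : X →ₗ[ℂ] Fiber X x :=
  (SeparationQuotient.mkCLM ℂ (PreFiber X x)).toLinearMap ∘ₗ
    ({ toFun := fun v => v, map_add' := fun _ _ => rfl, map_smul' := fun _ _ => rfl } :
      X →ₗ[ℂ] PreFiber X x)

theorem inner_fiberMk (v w : X) :
    inner ℂ (fiberMk X x v) (fiberMk X x w) = (inner C(K, ℂ) v w) x := rfl

theorem fiberMk_surjective : Function.Surjective (fiberMk X x) :=
  SeparationQuotient.surjective_mk (X := PreFiber X x)

theorem fiberMk_eq_zero_iff (v : X) : fiberMk X x v = 0 ↔ (inner C(K, ℂ) v v) x = 0 := by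
  rw [← inner_fiberMk, inner_self_eq_zero]

variable (K)

/-- The total space of the canonical bundle, the disjoint union of the fibres as a set. -/
structure TotalSpace where
  proj : K
  vec : Fiber X proj

variable {K}

/-- The topology of the canonical bundle, generated by the tubes around the sections
`x ↦ v + J_x`, `v ∈ X`, over open subsets of `K`. -/
instance : TopologicalSpace (TotalSpace K X) :=
  TopologicalSpace.generateFrom
    {T | ∃ (v : X) (U : Set K) (ε : ℝ), IsOpen U ∧ 0 < ε ∧
      T = {b : TotalSpace K X | b.proj ∈ U ∧ ‖b.vec - fiberMk X b.proj v‖ < ε}}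

/-- A chart of the canonical bundle over `U ⊆ K`: linear isomorphisms from `ℂᵏ` onto the fibres
over `U` that together form a homeomorphism from `U × ℂᵏ` onto the restriction of the bundle to
`U`. -/
structure Chart (U : Set K) (k : ℕ) where
  toFiber : ∀ x : U, EuclideanSpace ℂ (Fin k) ≃ₗ[ℂ] Fiber X (x : K)
  isHomeomorph : IsHomeomorph
    (fun q : U × EuclideanSpace ℂ (Fin k) =>
      (⟨⟨q.1, toFiber q.1 q.2⟩, q.1.2⟩ : {b : TotalSpace K X // b.proj ∈ U}))

variable (K)

/-- A local trivialisation of the canonical bundle: charts over the members of an open cover of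
`K`. -/
structure LocalTrivialisation where
  ι : Type u
  U : ι → Set K
  isOpen : ∀ i, IsOpen (U i)
  cover : ⋃ i, U i = Set.univ
  rank : ι → ℕ
  chart : ∀ i, Chart X (U i) (rank i)

variable {K X}

/-- All charts preserve the inner products of the fibres. -/
def LocalTrivialisation.IsUnitary (τ : LocalTrivialisation K X) : Prop :=
  ∀ (i : τ.ι) (x : τ.U i) (w z : EuclideanSpace ℂ (Fin (τ.rank i))),
    inner ℂ ((τ.chart i).toFiber x w) ((τ.chart i).toFiber x z) = inner ℂ w z

/-- The transition function from the `i`-th to the `j`-th chart at a point `x` of their overlap. -/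
noncomputable def LocalTrivialisation.transition (τ : LocalTrivialisation K X) (i j : τ.ι) (x : K)
    (hi : x ∈ τ.U i) (hj : x ∈ τ.U j) :
    EuclideanSpace ℂ (Fin (τ.rank i)) ≃ₗ[ℂ] EuclideanSpace ℂ (Fin (τ.rank j)) :=
  ((τ.chart i).toFiber ⟨x, hi⟩).trans ((τ.chart j).toFiber ⟨x, hj⟩).symm

/-- All transition functions are given by permutation matrices: they permute the standard basis
vectors. -/
def LocalTrivialisation.IsPermutationValued (τ : LocalTrivialisation K X) : Prop :=
  ∀ (i j : τ.ι) (x : K) (hi : x ∈ τ.U i) (hj : x ∈ τ.U j),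
    ∃ σ : Fin (τ.rank i) ≃ Fin (τ.rank j), ∀ l : Fin (τ.rank i),
      τ.transition i j x hi hj (EuclideanSpace.single l 1) = EuclideanSpace.single (σ l) 1

variable (K X)

/-- The canonical bundle has finite rank: its fibres are of finite and bounded dimension. -/
def HasFiniteRank : Prop :=
  ∃ N : ℕ, ∀ x : K, FiniteDimensional ℂ (Fiber X x) ∧ Module.finrank ℂ (Fiber X x) ≤ N

variable {K X}

/-- The members of a subset `B` of the total space that lie in the fibre over `x`. -/
def fiberSet (B : Set (TotalSpace K X)) (x : K) : Set (Fiber X x) := {ξ | ⟨x, ξ⟩ ∈ B}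

/-- A subset `B` of the canonical bundle is a continuous choice of finite orthonormal bases: it
meets each fibre in a finite orthonormal basis of that fibre, the bundle projection restricts to
a local homeomorphism `B → K`, and the number of basis vectors is locally constant. -/
structure IsContinuousChoiceOfBases (B : Set (TotalSpace K X)) : Prop where
  finite : ∀ x, (fiberSet B x).Finite
  orthonormal : ∀ x, Orthonormal ℂ (Subtype.val : fiberSet B x → Fiber X x)
  span_eq_top : ∀ x, Submodule.span ℂ (fiberSet B x) = ⊤
  isLocalHomeomorph : IsLocalHomeomorph (fun b : B => (b : TotalSpace K X).proj)
  isLocallyConstant : IsLocallyConstant fun x => (fiberSet B x).ncard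

end

end CanonicalBundle

/-! Every condition is compared with condition 2. The fibre of `X(E)` over `v` is the space of
functions on the finite set `s⁻¹(v)`, whose point masses form an orthonormal basis; as `e` varies
they trace out a copy of the edge space in the bundle. Conversely, a continuous choice of bases `B`
is compact and is itself an edge space, with the bundle projection as source map. The isomorphism
sends `v` to its coefficients `b ↦ ⟨b, v⟩`: Parseval in each fibre gives the inner products, and
bijectivity (`bijective_coefficients`) follows from a lower bound, completeness of `X` and a
partition of unity.

Locally, `B` is the same thing as continuous orthonormal frames that agree up to order
(`exists_frame`, `isContinuousChoiceOfBases_of_frames`). Such frames are unitary charts with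
permutation transitions, which gives condition 4.

The remaining point is that charts in condition 3 need not be unitary. The images of the standard
basis are therefore orthogonalized by the inverse square root of their Gram matrix. Unlike
Gram–Schmidt, this procedure commutes with reordering (`symmetricOrthogonalization_comp_equiv`), so
the new frames still differ by permutations on overlaps and together define a set `B`. -/

namespace CanonicalBundle

/-! ### Topology of the total space and continuity of sections -/

section Topology

variable {K : Type u} [TopologicalSpace K] [CompactSpace K]
  {X : Type v} [NormedAddCommGroup X] [NormedSpace ℂ X] [Module C(K, ℂ) X]
  [CStarModule C(K, ℂ) X]

theorem continuous_inner_fiberMk (v w : X) :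
    Continuous fun x : K => inner ℂ (fiberMk X x v) (fiberMk X x w) :=
  (inner C(K, ℂ) v w).continuous

theorem continuous_norm_fiberMk (v : X) : Continuous fun x : K => ‖fiberMk X x v‖ := by
  simp only [norm_eq_sqrt_re_inner (𝕜 := ℂ)]
  exact (RCLike.continuous_re.comp (continuous_inner_fiberMk v v)).sqrt

theorem norm_fiberMk_le (v : X) (x : K) : ‖fiberMk X x v‖ ≤ ‖v‖ := by
  have h : ‖fiberMk X x v‖ ^ 2 ≤ ‖v‖ ^ 2 := by
    rw [CStarModule.norm_sq_eq C(K, ℂ) (x := v), ← inner_self_eq_norm_sq (𝕜 := ℂ),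
      inner_fiberMk]
    exact (Complex.re_le_norm _).trans ((inner C(K, ℂ) v v).norm_coe_le_norm x)
  exact le_of_sq_le_sq h (norm_nonneg v)

theorem fiberMk_smul (a : C(K, ℂ)) (v : X) (x : K) :
    fiberMk X x (a • v) = a x • fiberMk X x v := by
  rw [← map_smul, ← sub_eq_zero, ← map_sub, fiberMk_eq_zero_iff]
  simp only [CStarModule.inner_sub_left, CStarModule.inner_sub_right,
    CStarModule.inner_op_smul_left, CStarModule.inner_op_smul_right,
    CStarModule.inner_smul_left_complex, CStarModule.inner_smul_right_complex]
  simp only [ContinuousMap.sub_apply, ContinuousMap.mul_apply, ContinuousMap.smul_apply,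
    ContinuousMap.star_apply, smul_eq_mul]
  ring

theorem isOpen_tube (v : X) {U : Set K} (hU : IsOpen U) {ε : ℝ} (hε : 0 < ε) :
    IsOpen {b : TotalSpace K X | b.proj ∈ U ∧ ‖b.vec - fiberMk X b.proj v‖ < ε} :=
  TopologicalSpace.isOpen_generateFrom_of_mem ⟨v, U, ε, hU, hε, rfl⟩

theorem continuous_proj : Continuous (TotalSpace.proj : TotalSpace K X → K) := by
  refine continuous_def.mpr fun U hU => isOpen_iff_forall_mem_open.mpr fun b hb => ?_
  -- A tube around the zero section, wide enough to contain `b`, lies over `U`.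
  exact ⟨_, fun c hc => hc.1, isOpen_tube 0 hU (ε := ‖b.vec‖ + 1) (by positivity),
    hb, by simp⟩

/-- If `w` represents `b.vec`, then points near `b` stay close to the section of `w`, so the
function is close to `‖w - v‖`, which is continuous on `K`. -/
theorem continuous_norm_sub_fiberMk (v : X) :
    Continuous fun b : TotalSpace K X => ‖b.vec - fiberMk X b.proj v‖ := by
  refine continuous_iff_continuousAt.mpr fun b => Metric.continuousAt_iff'.mpr fun ε hε => ?_
  obtain ⟨w, hw⟩ := fiberMk_surjective X b.proj b.vec
  have hd : Continuous fun c : TotalSpace K X => ‖fiberMk X c.proj (w - v)‖ :=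
    (continuous_norm_fiberMk (w - v)).comp continuous_proj
  have h1 := Metric.continuousAt_iff'.mp (hd.continuousAt (x := b)) (ε / 2) (half_pos hε)
  have h2 := (isOpen_tube w isOpen_univ (half_pos hε)).mem_nhds
    (show b ∈ {c : TotalSpace K X | c.proj ∈ Set.univ ∧ ‖c.vec - fiberMk X c.proj w‖ < ε / 2} by
      simpa [hw] using hε)
  filter_upwards [h1, h2] with c hc1 hc2
  have h3 := abs_norm_sub_norm_le (c.vec - fiberMk X c.proj v) (fiberMk X c.proj (w - v))
  have h4 : c.vec - fiberMk X c.proj v - fiberMk X c.proj (w - v)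
    = c.vec - fiberMk X c.proj w := by rw [map_sub]; abel
  rw [h4] at h3
  rw [Real.dist_eq] at hc1 ⊢
  have h5 : ‖b.vec - fiberMk X b.proj v‖ = ‖fiberMk X b.proj (w - v)‖ := by rw [map_sub, hw]
  rw [h5]
  have h6 := hc2.2
  rw [abs_le] at h3
  rw [abs_lt] at hc1 ⊢
  constructor <;> linarith

/-- Polarization reduces this to distances from the sections of `±v` and `±i v`. -/
theorem continuous_inner_fiberMk_vec (v : X) :
    Continuous fun b : TotalSpace K X => inner ℂ b.vec (fiberMk X b.proj v) := by
  have h : ∀ b : TotalSpace K X, inner ℂ b.vec (fiberMk X b.proj v) =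
      ((‖b.vec - fiberMk X b.proj (-v)‖ : ℂ) ^ 2 - (‖b.vec - fiberMk X b.proj v‖ : ℂ) ^ 2
        + ((‖b.vec - fiberMk X b.proj (Complex.I • v)‖ : ℂ) ^ 2
        - (‖b.vec - fiberMk X b.proj (-(Complex.I • v))‖ : ℂ) ^ 2) * Complex.I) / 4 := by
    intro b
    rw [inner_eq_sum_norm_sq_div_four]
    simp
  simp only [h]
  have := fun v : X => Complex.continuous_ofReal.comp (continuous_norm_sub_fiberMk (K := K) v)
  exact (((((this _).pow 2).sub ((this _).pow 2)).add
    ((((this _).pow 2).sub ((this _).pow 2)).mul continuous_const)).div_const _)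

instance [T2Space K] : T2Space (TotalSpace K X) := by
  refine ⟨fun b c hbc => ?_⟩
  by_cases hp : b.proj = c.proj
  · obtain ⟨w, hw⟩ := fiberMk_surjective X b.proj b.vec
    refine separated_by_continuous (continuous_norm_sub_fiberMk (K := K) w) fun h => hbc ?_
    obtain ⟨x, ξ⟩ := b
    obtain ⟨y, η⟩ := c
    obtain rfl : x = y := hp
    simp only [hw, sub_self, norm_zero] at h
    rw [eq_comm, norm_eq_zero, sub_eq_zero] at h
    rw [h]
  · exact separated_by_continuous continuous_proj hp

section Sections

variable {Z : Type*} [TopologicalSpace Z] {f : Z → K} {σ τ : ∀ z, Fiber X (f z)}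

theorem continuous_norm_sub_section (hσ : Continuous fun z => TotalSpace.mk (f z) (σ z)) (v : X) :
    Continuous fun z => ‖σ z - fiberMk X (f z) v‖ := by
  have h := (continuous_norm_sub_fiberMk (K := K) v).comp hσ
  exact h

theorem continuous_inner_section_fiberMk
    (hσ : Continuous fun z => TotalSpace.mk (f z) (σ z)) (v : X) :
    Continuous fun z => inner ℂ (σ z) (fiberMk X (f z) v) := by
  have h := (continuous_inner_fiberMk_vec (K := K) v).comp hσ
  exact h

/-- Near `z₀` the section `τ` is replaced by that of a fixed `w ∈ X` with the same value at `z₀`; by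
Cauchy–Schwarz the error tends to zero. -/
theorem continuous_inner_section (hσ : Continuous fun z => TotalSpace.mk (f z) (σ z))
    (hτ : Continuous fun z => TotalSpace.mk (f z) (τ z)) :
    Continuous fun z => inner ℂ (σ z) (τ z) := by
  refine continuous_iff_continuousAt.mpr fun z₀ => ?_
  obtain ⟨w, hw⟩ := fiberMk_surjective X (f z₀) (τ z₀)
  have h1 : Continuous fun z => inner ℂ (σ z) (fiberMk X (f z) w) :=
    continuous_inner_section_fiberMk hσ w
  have h2 : Continuous fun z => ‖σ z‖ * ‖τ z - fiberMk X (f z) w‖ := by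
    have h0 := continuous_norm_sub_section hσ 0
    simp only [map_zero, sub_zero] at h0
    exact h0.mul (continuous_norm_sub_section hτ w)
  have h3 : Filter.Tendsto (fun z => inner ℂ (σ z) (τ z - fiberMk X (f z) w)) (nhds z₀)
      (nhds 0) := by
    refine squeeze_zero_norm (fun z => norm_inner_le_norm _ _) ?_
    simpa [hw] using h2.tendsto z₀
  have h4 := ((h1.tendsto z₀).add h3).congr (f₂ := fun z => inner ℂ (σ z) (τ z))
    fun z => by rw [← inner_add_right, add_sub_cancel]
  rw [add_zero, hw] at h4
  exact h4

/-- The basic open sets are cut out by `‖σ - v‖`, whose square expands into inner products, so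
continuity into the total space can be tested on scalar functions. -/
theorem continuous_section (hf : Continuous f) (h : Continuous fun z => inner ℂ (σ z) (σ z))
    (hv : ∀ v : X, Continuous fun z => inner ℂ (fiberMk X (f z) v) (σ z)) :
    Continuous fun z => TotalSpace.mk (f z) (σ z) := by
  refine continuous_generateFrom_iff.mpr ?_
  rintro _ ⟨v, U, ε, hU, -, rfl⟩
  suffices hc : Continuous fun z => ‖σ z - fiberMk X (f z) v‖ from
    (hU.preimage hf).inter (isOpen_Iio.preimage hc)
  simp only [norm_eq_sqrt_re_inner (𝕜 := ℂ), inner_sub_left, inner_sub_right]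
  refine (RCLike.continuous_re.comp ?_).sqrt
  refine (h.sub (hv v)).sub (.sub ?_ ?_)
  · exact (Complex.continuous_conj.comp (hv v)).congr fun z => inner_conj_symm _ _
  · exact (continuous_inner_fiberMk v v).comp hf

theorem continuous_section_fiberMk (hf : Continuous f) (v : X) :
    Continuous fun z => TotalSpace.mk (f z) (fiberMk X (f z) v) :=
  continuous_section hf ((continuous_inner_fiberMk v v).comp hf)
    fun w => (continuous_inner_fiberMk w v).comp hf

theorem continuous_section_sum {ι : Type*} [Fintype ι] (hf : Continuous f) {c : ι → Z → ℂ}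
    {ρ : ι → ∀ z, Fiber X (f z)} (hc : ∀ i, Continuous (c i))
    (hρ : ∀ i, Continuous fun z => TotalSpace.mk (f z) (ρ i z)) :
    Continuous fun z => TotalSpace.mk (f z) (∑ i, c i z • ρ i z) := by
  refine continuous_section hf ?_ fun v => ?_
  · simp only [sum_inner, inner_sum, inner_smul_left, inner_smul_right]
    refine continuous_finsetSum _ fun i _ => (hc i).mul (continuous_finsetSum _ fun j _ => ?_)
    exact (Complex.continuous_conj.comp (hc j)).mul (continuous_inner_section (hρ j) (hρ i))
  · simp only [inner_sum, inner_smul_right]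
    exact continuous_finsetSum _ fun i _ => (hc i).mul
      (continuous_inner_section (continuous_section_fiberMk hf v) (hρ i))

end Sections

end Topology

end CanonicalBundle

/-! ### Continuous orthonormal frames and choices of bases -/

namespace CanonicalBundle

section Frames

variable {K : Type u} [TopologicalSpace K] [CompactSpace K]
  {X : Type v} [NormedAddCommGroup X] [NormedSpace ℂ X] [Module C(K, ℂ) X]
  [CStarModule C(K, ℂ) X]

variable (X) in
/-- A continuous orthonormal frame of the canonical bundle over `U ⊆ K`. -/
structure OrthonormalFrame (U : Set K) (k : ℕ) where
  basis : ∀ x : U, OrthonormalBasis (Fin k) ℂ (Fiber X (x : K))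
  continuous_basis : ∀ l, Continuous fun x : U => TotalSpace.mk (x : K) (basis x l)

namespace OrthonormalFrame

variable {U : Set K} {k : ℕ}

/-- The unitary chart given by a continuous orthonormal frame. -/
noncomputable def chart (F : OrthonormalFrame X U k) : Chart X U k where
  toFiber x := (F.basis x).repr.symm.toLinearEquiv
  isHomeomorph := by
    refine isHomeomorph_iff_exists_inverse.mpr ⟨?_, fun b => (⟨b.1.proj, b.2⟩,
      (F.basis ⟨b.1.proj, b.2⟩).repr b.1.vec), ?_, ?_, ?_⟩
    · refine Continuous.subtype_mk ?_ _
      have h := continuous_section_sum (X := X)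
        (f := fun q : U × EuclideanSpace ℂ (Fin k) => (q.1 : K))
        (c := fun l q => q.2 l) (ρ := fun l q => F.basis q.1 l) (by fun_prop)
        (fun l => by fun_prop) (fun l => (F.continuous_basis l).comp continuous_fst)
      refine h.congr fun q => ?_
      congr 1
      exact ((F.basis q.1).sum_repr_symm q.2)
    · intro q
      exact Prod.ext rfl ((F.basis q.1).repr.apply_symm_apply q.2)
    · intro b
      refine Subtype.ext ?_
      change TotalSpace.mk b.1.proj _ = TotalSpace.mk b.1.proj b.1.vec
      congr 1
      exact (F.basis ⟨b.1.proj, b.2⟩).repr.symm_apply_apply b.1.vec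
    · have hp : Continuous fun b : {b : TotalSpace K X // b.proj ∈ U} =>
          (⟨b.1.proj, b.2⟩ : U) :=
        (continuous_proj.comp continuous_subtype_val).subtype_mk _
      refine hp.prodMk ((PiLp.continuous_toLp 2 _).comp (continuous_pi fun l => ?_))
      have h := continuous_inner_section (X := X)
        (f := fun b : {b : TotalSpace K X // b.proj ∈ U} => b.1.proj)
        (σ := fun b => F.basis ⟨b.1.proj, b.2⟩ l) (τ := fun b => b.1.vec)
        ((F.continuous_basis l).comp hp) continuous_subtype_val
      exact h.congr fun b => ((F.basis ⟨b.1.proj, b.2⟩).repr_apply_apply _ _).symm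

theorem chart_toFiber_single (F : OrthonormalFrame X U k) (x : U) (l : Fin k) :
    F.chart.toFiber x (EuclideanSpace.single l 1) = F.basis x l :=
  (F.basis x).repr_symm_single l

theorem inner_chart_toFiber (F : OrthonormalFrame X U k) (x : U)
    (w z : EuclideanSpace ℂ (Fin k)) :
    inner ℂ (F.chart.toFiber x w) (F.chart.toFiber x z) = inner ℂ w z :=
  (F.basis x).repr.symm.inner_map_map w z

/-- The frame enumerates the part of `B` over `U`. -/
def Enumerates (F : OrthonormalFrame X U k) (B : Set (TotalSpace K X)) : Prop :=
  ∀ x : U, Set.range (F.basis x) = fiberSet B (x : K)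

theorem Enumerates.ncard_fiberSet {F : OrthonormalFrame X U k} {B : Set (TotalSpace K X)}
    (hF : F.Enumerates B) (x : U) : (fiberSet B (x : K)).ncard = k := by
  rw [← hF x, ← Set.image_univ, Set.ncard_image_of_injective _
    (F.basis x).orthonormal.linearIndependent.injective]
  simp

theorem Enumerates.exists_eq {F : OrthonormalFrame X U k} {B : Set (TotalSpace K X)}
    (hF : F.Enumerates B) {b : TotalSpace K X} (hb : b ∈ B) (hU : b.proj ∈ U) :
    ∃ l, F.basis ⟨b.proj, hU⟩ l = b.vec := by
  have h : b.vec ∈ fiberSet B b.proj := hb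
  rw [← hF ⟨b.proj, hU⟩] at h
  exact h

theorem Enumerates.mem {F : OrthonormalFrame X U k} {B : Set (TotalSpace K X)}
    (hF : F.Enumerates B) (x : U) (l : Fin k) : TotalSpace.mk (x : K) (F.basis x l) ∈ B := by
  have h : F.basis x l ∈ fiberSet B (x : K) := hF x ▸ Set.mem_range_self l
  exact h

/-- Each frame vector is a section `U → B`. Its image is open: a member of `B` over `U` is either
the frame vector or orthogonal to it, so the image is where their inner product is nonzero. -/
theorem Enumerates.isLocalHomeomorphOn {F : OrthonormalFrame X U k} {B : Set (TotalSpace K X)}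
    (hF : F.Enumerates B) (hU : IsOpen U) :
    IsLocalHomeomorphOn (fun b : B => (b : TotalSpace K X).proj) {b | b.1.proj ∈ U} := by
  rintro b hb
  obtain ⟨l, hl⟩ := hF.exists_eq b.2 hb
  let s : U → B := fun x => ⟨_, hF.mem x l⟩
  have hs : Continuous s := (F.continuous_basis l).subtype_mk _
  have hp : Continuous fun b : B => (b : TotalSpace K X).proj :=
    continuous_proj.comp continuous_subtype_val
  have hsv : Topology.IsOpenEmbedding ((fun b : B => (b : TotalSpace K X).proj) ∘ s) :=
    hU.isOpenEmbedding_subtypeVal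
  have hse : Topology.IsOpenEmbedding s := by
    refine ⟨hsv.isEmbedding.of_comp hs hp, ?_⟩
    let W : Set B := {c | c.1.proj ∈ U}
    have hW : IsOpen W := hU.preimage hp
    have hpW : Continuous fun c : W => (⟨c.1.1.proj, c.2⟩ : U) :=
      (hp.comp continuous_subtype_val).subtype_mk _
    have hi := continuous_inner_section (X := X) (f := fun c : W => c.1.1.proj)
      (σ := fun c => F.basis ⟨c.1.1.proj, c.2⟩ l) (τ := fun c => c.1.1.vec)
      ((F.continuous_basis l).comp hpW) (continuous_subtype_val.comp continuous_subtype_val)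
    have ho := hW.isOpenMap_subtype_val _ ((isOpen_compl_singleton (x := (0 : ℂ))).preimage hi)
    convert ho
    ext c
    constructor
    · rintro ⟨x, rfl⟩
      refine ⟨⟨s x, x.2⟩, ?_, rfl⟩
      have h1 : inner ℂ (F.basis x l) (F.basis x l) = (1 : ℂ) := by
        simp [(F.basis x).orthonormal.1 l]
      change inner ℂ (F.basis x l) (F.basis x l) ≠ (0 : ℂ)
      rw [h1]
      exact one_ne_zero
    · rintro ⟨⟨c, hc⟩, hne, rfl⟩
      obtain ⟨m, hm⟩ := hF.exists_eq c.2 hc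
      refine ⟨⟨c.1.proj, hc⟩, Subtype.ext ?_⟩
      change TotalSpace.mk c.1.proj _ = TotalSpace.mk c.1.proj c.1.vec
      congr 1
      rw [← hm]
      by_contra hlm
      refine hne ?_
      change inner ℂ (F.basis ⟨c.1.proj, hc⟩ l) c.1.vec = (0 : ℂ)
      rw [← hm]
      exact (F.basis ⟨c.1.proj, hc⟩).orthonormal.2 fun h => hlm (by rw [h])
  -- The projection after `s` is the open inclusion of `U`, and `s` is a local homeomorphism, so the
  -- projection is one on the image of `s`.
  refine hsv.isLocalHomeomorph.isLocalHomeomorphOn.of_comp_right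
    (s := Set.univ) hse.isLocalHomeomorph.isLocalHomeomorphOn b ⟨⟨b.1.proj, hb⟩, trivial, ?_⟩
  refine Subtype.ext ?_
  change TotalSpace.mk b.1.proj _ = TotalSpace.mk b.1.proj b.1.vec
  congr 1

end OrthonormalFrame

open OrthonormalFrame in
theorem isContinuousChoiceOfBases_of_frames {B : Set (TotalSpace K X)}
    (h : ∀ x : K, ∃ (U : Set K) (k : ℕ) (F : OrthonormalFrame X U k),
      IsOpen U ∧ x ∈ U ∧ F.Enumerates B) : IsContinuousChoiceOfBases B where
  finite x := by
    obtain ⟨U, k, F, -, hx, hF⟩ := h x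
    rw [← hF ⟨x, hx⟩]
    exact Set.finite_range _
  orthonormal x := by
    obtain ⟨U, k, F, -, hx, hF⟩ := h x
    rw [← hF ⟨x, hx⟩]
    exact (F.basis ⟨x, hx⟩).orthonormal.toSubtypeRange
  span_eq_top x := by
    obtain ⟨U, k, F, -, hx, hF⟩ := h x
    rw [← hF ⟨x, hx⟩, ← (F.basis ⟨x, hx⟩).coe_toBasis]
    exact (F.basis ⟨x, hx⟩).toBasis.span_eq
  isLocalHomeomorph b := by
    obtain ⟨U, k, F, hU, hx, hF⟩ := h b.1.proj
    exact hF.isLocalHomeomorphOn hU b hx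
  isLocallyConstant := by
    refine (IsLocallyConstant.iff_eventually_eq _).mpr fun x => ?_
    obtain ⟨U, k, F, hU, hx, hF⟩ := h x
    filter_upwards [hU.mem_nhds hx] with y hy
    rw [hF.ncard_fiberSet ⟨x, hx⟩, hF.ncard_fiberSet ⟨y, hy⟩]

/-- Each of the finitely many members of `B` over `x` extends to a local section of `B`. Near `x`
these sections stay distinct because the total space is Hausdorff, and local constancy of the
cardinality leaves no room for other members of `B`. -/
theorem IsContinuousChoiceOfBases.exists_frame [T2Space K] {B : Set (TotalSpace K X)}
    (hB : IsContinuousChoiceOfBases B) (x : K) : ∃ (U : Set K) (k : ℕ)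
      (F : OrthonormalFrame X U k), IsOpen U ∧ x ∈ U ∧ F.Enumerates B := by
  have := (hB.finite x).to_subtype
  let en : Fin (Nat.card (fiberSet B x)) ≃ fiberSet B x := (Finite.equivFin _).symm
  have hloc := fun l => hB.isLocalHomeomorph ⟨⟨x, (en l).1⟩, (en l).2⟩
  choose e he hpe using hloc
  have hpe' : ∀ l (b : B), e l b = b.1.proj := fun l b => (congrFun (hpe l) b).symm
  have hxe : ∀ l, e l ⟨⟨x, (en l).1⟩, (en l).2⟩ = x := fun l => hpe' l _
  have hxt : ∀ l, x ∈ (e l).target := fun l => by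
    simpa only [hxe] using (e l).map_source (he l)
  have hsx : ∀ l, (e l).symm x = ⟨⟨x, (en l).1⟩, (en l).2⟩ := fun l => by
    simpa only [hxe] using (e l).left_inv (he l)
  have hev : ∀ᶠ y in nhds x, (∀ l, y ∈ (e l).target) ∧
      (∀ l m, l ≠ m → (e l).symm y ≠ (e m).symm y) ∧
      (fiberSet B y).ncard = (fiberSet B x).ncard := by
    refine .and (Filter.eventually_all.mpr fun l => (e l).open_target.mem_nhds (hxt l))
      (.and ?_ ((IsLocallyConstant.iff_eventually_eq _).mp hB.isLocallyConstant x))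
    refine Filter.eventually_all.mpr fun l => Filter.eventually_all.mpr fun m => ?_
    by_cases hlm : l = m
    · exact .of_forall fun _ h => (h hlm).elim
    · have hne : (e l).symm x ≠ (e m).symm x := by
        rw [hsx, hsx]
        intro h
        have h1 := congrArg Subtype.val h
        simp only [TotalSpace.mk.injEq, heq_eq_eq, true_and] at h1
        exact hlm (en.injective (Subtype.ext h1))
      filter_upwards [(((e l).continuousAt_symm (hxt l)).ne_iff_eventually_ne
        ((e m).continuousAt_symm (hxt m))).mp hne] with y hy _ using hy
  obtain ⟨U, hU, hUo, hxU⟩ := eventually_nhds_iff.mp hev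
  have hξ : ∀ (y : U) l, ∃ ξ : Fiber X (y : K), TotalSpace.mk (y : K) ξ = ((e l).symm y).1 := by
    intro y l
    have h : ((e l).symm y).1.proj = (y : K) := by
      rw [← hpe' l, (e l).right_inv ((hU y y.2).1 l)]
    generalize ((e l).symm y).1 = b at h
    rw [← h]
    exact ⟨b.vec, rfl⟩
  choose ξ hξ using hξ
  have hmem : ∀ (y : U) l, ξ y l ∈ fiberSet B (y : K) := fun y l => by
    change TotalSpace.mk (y : K) (ξ y l) ∈ B
    rw [hξ]
    exact Subtype.coe_prop _
  have hinj : ∀ y, Function.Injective (ξ y) := fun y l m h => by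
    by_contra hlm
    refine (hU y y.2).2.1 l m hlm (Subtype.ext ?_)
    rw [← hξ, ← hξ, h]
  have hrange : ∀ y : U, Set.range (ξ y) = fiberSet B (y : K) := fun y => by
    refine Set.eq_of_subset_of_ncard_le (Set.range_subset_iff.mpr (hmem y)) ?_ (hB.finite y)
    rw [(hU y y.2).2.2, ← Set.image_univ, Set.ncard_image_of_injective _ (hinj y)]
    simp [Nat.card_coe_set_eq]
  have hon : ∀ y, Orthonormal ℂ (ξ y) := fun y =>
    (hB.orthonormal y).comp (fun l => ⟨ξ y l, hmem y l⟩)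
      fun l m h => hinj y (congrArg Subtype.val h)
  refine ⟨U, _, ⟨fun y => OrthonormalBasis.mk (hon y)
    (by rw [hrange, hB.span_eq_top]), fun l => ?_⟩, hUo, hxU, fun y => ?_⟩
  · simp only [OrthonormalBasis.coe_mk, hξ]
    exact continuous_subtype_val.comp ((e l).continuousOn_symm.comp_continuous
      continuous_subtype_val fun y => (hU y y.2).1 l)
  · simp only [OrthonormalBasis.coe_mk, hrange]

end Frames

end CanonicalBundle

/-! ### Inverse square roots of positive definite matrices -/

namespace Matrix

open scoped Matrix.Norms.L2Operator

variable {n m : Type*} [Fintype n] [DecidableEq n] [Fintype m] [DecidableEq m]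

/-- The inverse of the square root of a positive definite matrix. -/
noncomputable def invSqrt (M : Matrix n n ℂ) : Matrix n n ℂ := cfc (fun t : ℝ => (√t)⁻¹) M

theorem continuousOn_inv_sqrt : ContinuousOn (fun t : ℝ => (√t)⁻¹) (Set.Ioi 0) :=
  Real.continuous_sqrt.continuousOn.inv₀ fun _ ht => (Real.sqrt_pos.mpr ht).ne'

theorem PosDef.spectrum_subset_Ioi {M : Matrix n n ℂ} (hM : M.PosDef) :
    spectrum ℝ M ⊆ Set.Ioi 0 := by
  rw [hM.isHermitian.spectrum_real_eq_range_eigenvalues]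
  rintro _ ⟨i, rfl⟩
  exact hM.eigenvalues_pos i

theorem conjTranspose_invSqrt (M : Matrix n n ℂ) : M.invSqrtᴴ = M.invSqrt :=
  cfc_predicate (p := IsSelfAdjoint) (fun t : ℝ => (√t)⁻¹) M

theorem PosDef.invSqrt_mul_mul_invSqrt {M : Matrix n n ℂ} (hM : M.PosDef) :
    M.invSqrt * M * M.invSqrt = 1 := by
  have hs : IsSelfAdjoint M := hM.isHermitian
  have hc := continuousOn_inv_sqrt.mono hM.spectrum_subset_Ioi
  have h1 : M.invSqrt * M * M.invSqrt =
      cfc (fun t : ℝ => (√t)⁻¹) M * cfc (fun t : ℝ => t) M * cfc (fun t : ℝ => (√t)⁻¹) M := by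
    rw [cfc_id' ℝ M, invSqrt]
  have hc' : ContinuousOn (fun t : ℝ => (√t)⁻¹ * t) (spectrum ℝ M) := hc.mul continuousOn_id
  rw [h1, ← cfc_mul _ _ M hc (continuousOn_id' _), ← cfc_mul _ _ M hc' hc, ← cfc_one ℝ M]
  refine cfc_congr fun t ht => ?_
  have ht0 := hM.spectrum_subset_Ioi ht
  have := (Real.sqrt_pos.mpr ht0).ne'
  simp only [Pi.one_apply]
  field_simp
  exact (Real.sq_sqrt ht0.le).symm

/-- The spectra stay in the open half-line, where `t ↦ (√t)⁻¹` is continuous, so the functional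
calculus depends continuously on the matrix. -/
theorem continuous_invSqrt {Z : Type*} [TopologicalSpace Z] {M : Z → Matrix n n ℂ}
    (hM : Continuous M) (hpos : ∀ z, (M z).PosDef) : Continuous fun z => (M z).invSqrt := by
  refine Continuous.cfc_of_mem_nhdsSet (s := Set.Ioi 0) _ ?_ hM (fun z => (hpos z).isHermitian)
    continuousOn_inv_sqrt
  exact isOpen_Ioi.mem_nhdsSet.mpr (Set.iUnion_subset fun z => (hpos z).spectrum_subset_Ioi)

/-- Reindexing is a continuous star-algebra isomorphism and so commutes with the functional
calculus. -/
theorem PosDef.invSqrt_submatrix {M : Matrix m m ℂ} (hM : M.PosDef) (e : n ≃ m) :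
    (M.submatrix e e).invSqrt = M.invSqrt.submatrix e e := by
  let φ : Matrix m m ℂ ≃⋆ₐ[ℂ] Matrix n n ℂ :=
    { reindexAlgEquiv ℂ ℂ e.symm with
      map_star' := fun A => rfl
      map_smul' := fun c A => rfl }
  have hφ : Continuous φ := continuous_id.matrix_submatrix e e
  exact (StarAlgHomClass.map_cfc (S := ℂ) φ (fun t : ℝ => (√t)⁻¹) M
    (continuousOn_inv_sqrt.mono hM.spectrum_subset_Ioi) hφ hM.isHermitian
    (hM.isHermitian.submatrix e)).symm

end Matrix

/-! ### Symmetric orthogonalization -/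

section SymmetricOrthogonalization

theorem gram_sum_smul {ι H : Type*} [Fintype ι] [NormedAddCommGroup H] [InnerProductSpace ℂ H]
    (v : ι → H) (A : Matrix ι ι ℂ) :
    Matrix.gram ℂ (fun l => ∑ m, A m l • v m) = A.conjTranspose * Matrix.gram ℂ v * A := by
  ext l n
  simp only [Matrix.gram_apply, sum_inner, inner_sum, inner_smul_left, inner_smul_right,
    Matrix.mul_apply, Matrix.conjTranspose_apply, Finset.sum_mul]
  exact Finset.sum_congr rfl fun i _ => by simp [Finset.mul_sum, mul_comm]

variable {ι κ : Type*} [Fintype ι] [DecidableEq ι] [Fintype κ] [DecidableEq κ]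
  {H : Type*} [NormedAddCommGroup H] [InnerProductSpace ℂ H]

/-- The symmetric (Löwdin) orthogonalization of a linearly independent family. -/
noncomputable def symmetricOrthogonalization (v : ι → H) (l : ι) : H :=
  ∑ m, (Matrix.gram ℂ v).invSqrt m l • v m

theorem orthonormal_symmetricOrthogonalization {v : ι → H} (hv : LinearIndependent ℂ v) :
    Orthonormal ℂ (symmetricOrthogonalization v) := by
  rw [← Matrix.gram_eq_one_iff_orthonormal]
  unfold symmetricOrthogonalization
  rw [gram_sum_smul, Matrix.conjTranspose_invSqrt]
  exact (Matrix.posDef_gram_of_linearIndependent hv).invSqrt_mul_mul_invSqrt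

/-- The Gram matrix of the reordered family is the reindexed Gram matrix, and no order of the
vectors enters the construction. -/
theorem symmetricOrthogonalization_comp_equiv {v : κ → H} (hv : LinearIndependent ℂ v)
    (e : ι ≃ κ) (l : ι) :
    symmetricOrthogonalization (v ∘ e) l = symmetricOrthogonalization v (e l) := by
  have h : Matrix.gram ℂ (v ∘ e) = (Matrix.gram ℂ v).submatrix e e := rfl
  simp only [symmetricOrthogonalization, h,
    (Matrix.posDef_gram_of_linearIndependent hv).invSqrt_submatrix e]
  exact e.sum_comp fun m => (Matrix.gram ℂ v).invSqrt m (e l) • v m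

end SymmetricOrthogonalization

/-! ### Local trivialisations and choices of bases -/

namespace CanonicalBundle

section Charts

variable {K : Type u} [TopologicalSpace K] [CompactSpace K]
  {X : Type v} [NormedAddCommGroup X] [NormedSpace ℂ X] [Module C(K, ℂ) X]
  [CStarModule C(K, ℂ) X]

namespace Chart

variable {U : Set K} {k : ℕ} (C : Chart X U k)

/-- The images of the standard basis vectors under a chart. -/
noncomputable def vector (x : U) (l : Fin k) : Fiber X (x : K) :=
  C.toFiber x (EuclideanSpace.single l 1)

theorem linearIndependent_vector (x : U) : LinearIndependent ℂ (C.vector x) := by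
  have h := (EuclideanSpace.basisFun (Fin k) ℂ).orthonormal.linearIndependent.map'
    (C.toFiber x).toLinearMap (C.toFiber x).ker
  have hv : C.vector x =
      (C.toFiber x).toLinearMap ∘ EuclideanSpace.basisFun (Fin k) ℂ := by
    ext l
    simp [vector]
  rw [hv]
  exact h

theorem continuous_vector (l : Fin k) :
    Continuous fun x : U => TotalSpace.mk (x : K) (C.vector x l) :=
  continuous_subtype_val.comp (C.isHomeomorph.continuous.comp
    (Continuous.prodMk continuous_id (continuous_const (y := EuclideanSpace.single l 1))))

/-- The orthonormal frame obtained from a chart by symmetric orthogonalization. -/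
noncomputable def orthonormalFrame : OrthonormalFrame X U k where
  basis x := OrthonormalBasis.mk
    (orthonormal_symmetricOrthogonalization (C.linearIndependent_vector x)) (by
      have : FiniteDimensional ℂ (Fiber X (x : K)) := (C.toFiber x).finiteDimensional
      refine (LinearIndependent.span_eq_top_of_card_eq_finrank'
        (orthonormal_symmetricOrthogonalization (C.linearIndependent_vector x)).linearIndependent
        ?_).ge
      rw [← (C.toFiber x).finrank_eq]
      simp)
  continuous_basis l := by
    simp only [OrthonormalBasis.coe_mk]
    refine continuous_section_sum continuous_subtype_val (fun m => ?_) C.continuous_vector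
    have h : Continuous fun x : U => (Matrix.gram ℂ (C.vector x)).invSqrt := by
      refine Matrix.continuous_invSqrt (continuous_matrix fun i j => ?_) fun x =>
        Matrix.posDef_gram_of_linearIndependent (C.linearIndependent_vector x)
      exact continuous_inner_section (C.continuous_vector i) (C.continuous_vector j)
    exact h.matrix_elem m l

theorem orthonormalFrame_basis (x : U) (l : Fin k) :
    C.orthonormalFrame.basis x l = symmetricOrthogonalization (C.vector x) l := by
  simp [orthonormalFrame]

end Chart

/-- `B` is the union of the orthogonalized frames of all charts. On an overlap these frames are
reorderings of each other, so the frame of any single chart already enumerates `B` over its domain.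
-/
theorem exists_isContinuousChoiceOfBases_of_localTrivialisation
    (τ : LocalTrivialisation K X) (hτ : τ.IsPermutationValued) :
    ∃ B : Set (TotalSpace K X), IsContinuousChoiceOfBases B := by
  refine ⟨{b | ∃ (i : τ.ι) (h : b.proj ∈ τ.U i) (l : Fin (τ.rank i)),
    (τ.chart i).orthonormalFrame.basis ⟨b.proj, h⟩ l = b.vec},
    isContinuousChoiceOfBases_of_frames fun x => ?_⟩
  obtain ⟨i, hi⟩ := Set.mem_iUnion.mp (τ.cover ▸ Set.mem_univ x)
  refine ⟨τ.U i, τ.rank i, (τ.chart i).orthonormalFrame, τ.isOpen i, hi, fun y => ?_⟩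
  refine Set.Subset.antisymm ?_ ?_
  · rintro _ ⟨l, rfl⟩
    exact ⟨i, y.2, l, rfl⟩
  · rintro _ ⟨j, hj, l, hl⟩
    refine Set.mem_of_eq_of_mem hl.symm ?_
    obtain ⟨σ, hσ⟩ := hτ j i y hj y.2
    have hv : (τ.chart j).vector ⟨y, hj⟩ = (τ.chart i).vector y ∘ σ := funext fun l =>
      (LinearEquiv.symm_apply_eq _).mp (hσ l)
    refine ⟨σ l, ?_⟩
    rw [Chart.orthonormalFrame_basis, Chart.orthonormalFrame_basis]
    change _ = symmetricOrthogonalization ((τ.chart j).vector ⟨y, hj⟩) l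
    rw [hv, symmetricOrthogonalization_comp_equiv ((τ.chart i).linearIndependent_vector y)]

theorem IsContinuousChoiceOfBases.hasFiniteRank {B : Set (TotalSpace K X)}
    (hB : IsContinuousChoiceOfBases B) : HasFiniteRank K X := by
  -- A locally constant function on the compact space `K` takes finitely many values.
  obtain ⟨N, hN⟩ := hB.isLocallyConstant.range_finite.bddAbove
  refine ⟨N, fun x => ?_⟩
  have hfd : FiniteDimensional ℂ (Fiber X x) :=
    Module.finite_def.mpr (hB.span_eq_top x ▸ Submodule.fg_span (hB.finite x))
  refine ⟨hfd, le_trans ?_ (hN (Set.mem_range_self x))⟩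
  have := (hB.finite x).fintype
  rw [← finrank_top, ← hB.span_eq_top x, Set.ncard_eq_toFinset_card']
  exact finrank_span_le_card _

theorem IsContinuousChoiceOfBases.exists_localTrivialisation [T2Space K]
    {B : Set (TotalSpace K X)} (hB : IsContinuousChoiceOfBases B) :
    ∃ τ : LocalTrivialisation K X, τ.IsUnitary ∧ τ.IsPermutationValued := by
  choose U k F hU hx hF using hB.exists_frame
  refine ⟨⟨K, U, hU, Set.iUnion_eq_univ_iff.mpr fun x => ⟨x, hx x⟩, k, fun x => (F x).chart⟩,
    fun x => (F x).inner_chart_toFiber, fun i j x hi hj => ?_⟩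
  -- Both frames enumerate the same finite set over `x`; comparing the enumerations gives the
  -- permutation.
  let f : Fin (k i) ≃ fiberSet B x := (Equiv.ofInjective _
    ((F i).basis ⟨x, hi⟩).orthonormal.linearIndependent.injective).trans
      (Equiv.setCongr (hF i ⟨x, hi⟩))
  let g : Fin (k j) ≃ fiberSet B x := (Equiv.ofInjective _
    ((F j).basis ⟨x, hj⟩).orthonormal.linearIndependent.injective).trans
      (Equiv.setCongr (hF j ⟨x, hj⟩))
  refine ⟨f.trans g.symm, fun l => (LinearEquiv.symm_apply_eq _).mpr ?_⟩
  change (F i).chart.toFiber ⟨x, hi⟩ _ = (F j).chart.toFiber ⟨x, hj⟩ _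
  rw [OrthonormalFrame.chart_toFiber_single, OrthonormalFrame.chart_toFiber_single]
  exact congrArg Subtype.val (g.apply_symm_apply (f l)).symm

end Charts

end CanonicalBundle

/-! ### From a graph to a choice of bases -/

namespace CompactTopologicalGraph

variable (E : CompactTopologicalGraph.{u})

/-- The cardinality is the fibre sum of the constant function `1`, and `ℕ` embeds in `ℝ`. -/
theorem continuous_card_fiber :
    Continuous fun v : E.Vertex => (E.finite_fiber v).toFinset.card := by
  refine Nat.isClosedEmbedding_coe_real.isEmbedding.isInducing.continuous_iff.mpr ?_
  refine (Complex.continuous_re.comp (E.continuous_fiberSum (f := 1) continuous_one)).congr ?_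
  intro v
  simp [fiberSum]

/-- By Urysohn, `e` is separated from the other edges with the same source, which form a finite and
hence closed set. In the fibre, `ξ` represents the point mass at `e`. -/
theorem exists_eq_ite (e : E.Edge) : ∃ ξ : C(E.Edge, ℂ), ξ e = 1 ∧
    ∀ e', E.source e' = E.source e → e' ≠ e → ξ e' = 0 := by
  obtain ⟨g, hg0, hg1, -⟩ := exists_continuous_zero_one_of_isClosed
    (s := E.source ⁻¹' {E.source e} \ {e}) (t := {e})
    ((E.finite_fiber _).subset Set.sdiff_subset).isClosed isClosed_singleton
    Set.disjoint_sdiff_left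
  refine ⟨⟨fun x => (g x : ℂ), by fun_prop⟩, ?_, fun e' h he => ?_⟩
  · simpa using hg1 rfl
  · simpa using hg0 ⟨h, he⟩

end CompactTopologicalGraph

namespace CanonicalBundle

section GraphToBases

variable {K : Type u} [TopologicalSpace K] [CompactSpace K] [T2Space K]
  {X : Type v} [NormedAddCommGroup X] [NormedSpace ℂ X] [Module C(K, ℂ) X]
  [CStarModule C(K, ℂ) X]

open CompactTopologicalGraph in
theorem exists_isContinuousChoiceOfBases_of_iso (E : CompactTopologicalGraph.{u})
    (h : E.Vertex ≃ₜ K) (Φ : HilbertModuleIso h X E.GraphModule) :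
    ∃ B : Set (TotalSpace K X), IsContinuousChoiceOfBases B := by
  have hin : ∀ (v w : X) (u : E.Vertex), inner ℂ (fiberMk X (h u) v) (fiberMk X (h u) w) =
      ∑ e ∈ (E.finite_fiber u).toFinset,
        star ((Φ.toLinearEquiv v).toMap e) * (Φ.toLinearEquiv w).toMap e := fun v w u =>
    (DFunLike.congr_fun (Φ.map_inner v w) u).symm
  have hξ : ∀ e : E.Edge, ∃ v : X, (Φ.toLinearEquiv v).toMap e = 1 ∧
      ∀ e', E.source e' = E.source e → e' ≠ e → (Φ.toLinearEquiv v).toMap e' = 0 := fun e => by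
    obtain ⟨g, hg⟩ := E.exists_eq_ite e
    refine ⟨Φ.toLinearEquiv.symm (show E.GraphModule from g), ?_⟩
    rw [LinearEquiv.apply_symm_apply]
    exact hg
  choose ξ hξ1 hξ0 using hξ
  -- Pairing with the point mass at `e` is evaluation at `e`; all later properties of `ξ` come from
  -- this formula.
  have hξin : ∀ (e : E.Edge) (v : X), inner ℂ (fiberMk X (h (E.source e)) (ξ e))
      (fiberMk X (h (E.source e)) v) = (Φ.toLinearEquiv v).toMap e := fun e v => by
    rw [hin, Finset.sum_eq_single e]
    · simp [hξ1]
    · intro e' he' hne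
      rw [hξ0 e e' (by simpa using he') hne]
      simp
    · simp
  let b : E.Edge → TotalSpace K X := fun e => ⟨h (E.source e), fiberMk X _ (ξ e)⟩
  -- The choice of `ξ e` need not be continuous in `e`, but its inner products with itself and with
  -- each `v ∈ X` are.
  have hbc : Continuous b := by
    refine continuous_section (h.continuous.comp E.isLocalHomeomorph_source.continuous) ?_
      fun v => ?_
    · simp only [hξin, hξ1]
      exact continuous_const
    · refine (Complex.continuous_conj.comp (Φ.toLinearEquiv v).toMap.continuous).congr fun e => ?_
      rw [← inner_conj_symm, hξin]
      rfl
  have hbi : Function.Injective b := fun e e' hee => by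
    have hs : E.source e' = E.source e := h.injective (congrArg TotalSpace.proj hee).symm
    by_contra hne
    have h1 := congrArg (fun b : TotalSpace K X => inner ℂ b.vec (fiberMk X b.proj (ξ e))) hee
    simp only [b, hξin, hξ1, hξ0 e e' hs (Ne.symm hne)] at h1
    exact one_ne_zero h1
  have hfib : ∀ u, fiberSet (Set.range b) (h u) =
      Set.range fun e : E.source ⁻¹' {u} => fiberMk X (h u) (ξ e) := fun u => by
    ext ζ
    constructor
    · rintro ⟨e, he⟩
      obtain rfl : E.source e = u := h.injective (congrArg TotalSpace.proj he)
      simp only [b, TotalSpace.mk.injEq, heq_eq_eq, true_and] at he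
      exact ⟨⟨e, rfl⟩, he⟩
    · rintro ⟨⟨e, rfl⟩, rfl⟩
      exact ⟨e, rfl⟩
  have hon : ∀ u, Orthonormal ℂ fun e : E.source ⁻¹' {u} => fiberMk X (h u) (ξ e) := fun u => by
    classical
    rw [orthonormal_iff_ite]
    rintro ⟨e, rfl⟩ ⟨e', he'⟩
    rw [hξin]
    by_cases hee : e = e'
    · subst hee
      simp [hξ1]
    · rw [hξ0 e' e (Eq.symm he') hee, if_neg fun h => hee (congrArg Subtype.val h)]
  refine ⟨Set.range b, fun x => ?_, fun x => ?_, fun x => ?_, ?_, ?_⟩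
  · obtain ⟨u, rfl⟩ := h.surjective x
    have := (E.finite_fiber u).to_subtype
    rw [hfib]
    exact Set.finite_range _
  · obtain ⟨u, rfl⟩ := h.surjective x
    rw [hfib]
    exact (hon u).toSubtypeRange
  · obtain ⟨u, rfl⟩ := h.surjective x
    have := (E.finite_fiber u).to_subtype
    rw [hfib]
    have := FiniteDimensional.span_of_finite ℂ
      (Set.finite_range fun e : E.source ⁻¹' {u} => fiberMk X (h u) (ξ e))
    -- A vector orthogonal to every point mass has a representative vanishing on all edges with
    -- source `u`, so its norm is zero.
    rw [← Submodule.orthogonal_eq_bot_iff, Submodule.eq_bot_iff]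
    intro ζ hζ
    obtain ⟨v, rfl⟩ := fiberMk_surjective X (h u) ζ
    rw [← inner_self_eq_zero (𝕜 := ℂ), hin]
    refine Finset.sum_eq_zero fun e he => ?_
    obtain rfl : E.source e = u := by simpa using he
    rw [← hξin e v, (Submodule.mem_orthogonal _ _).mp hζ _
      (Submodule.subset_span ⟨⟨e, rfl⟩, rfl⟩), mul_zero]
  -- A continuous injection from a compact space into a Hausdorff space is an embedding, and the
  -- projection corresponds to `h ∘ s` under it.
  · let H : E.Edge ≃ₜ Set.range b := (hbc.isClosedEmbedding hbi).isEmbedding.toHomeomorph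
    have h1 := (h.isLocalHomeomorph.comp E.isLocalHomeomorph_source).comp H.symm.isLocalHomeomorph
    refine (funext fun c => ?_ : _ = fun c : Set.range b => c.1.proj) ▸ h1
    obtain ⟨e, rfl⟩ := H.surjective c
    simp only [Function.comp_apply, H.symm_apply_apply]
    rfl
  · refine IsLocallyConstant.iff_continuous _ |>.mpr ?_
    refine (E.continuous_card_fiber.comp h.symm.continuous).congr fun x => ?_
    obtain ⟨u, rfl⟩ := h.surjective x
    rw [hfib, ← Set.image_univ, Set.ncard_image_of_injective _ (hon u).linearIndependent.injective,
      Set.ncard_univ, Nat.card_coe_set_eq, Set.ncard_eq_toFinset_card _ (E.finite_fiber u)]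
    simp

end GraphToBases

end CanonicalBundle

/-! ### From a choice of bases to a graph -/

namespace CanonicalBundle

section BasesToGraph

variable {K : Type u} [TopologicalSpace K] [CompactSpace K]
  {X : Type v} [NormedAddCommGroup X] [NormedSpace ℂ X] [Module C(K, ℂ) X]
  [CStarModule C(K, ℂ) X]

/-- The coefficients `b ↦ ⟨b, v⟩` of an element `v` of the module with respect to the members of a
subset `B` of the canonical bundle. -/
noncomputable def coefficients (B : Set (TotalSpace K X)) : X →ₗ[ℂ] C(B, ℂ) where
  toFun v := ⟨fun b => inner ℂ b.1.vec (fiberMk X b.1.proj v),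
    (continuous_inner_fiberMk_vec v).comp continuous_subtype_val⟩
  map_add' v w := by
    ext b
    simp [inner_add_right]
  map_smul' c v := by
    ext b
    simp [inner_smul_right]

theorem coefficients_apply (B : Set (TotalSpace K X)) (v : X) (b : B) :
    coefficients B v b = inner ℂ b.1.vec (fiberMk X b.1.proj v) := rfl

theorem coefficients_action (B : Set (TotalSpace K X)) (a : C(K, ℂ)) (v : X) (b : B) :
    coefficients B (a • v) b = a b.1.proj * coefficients B v b := by
  rw [coefficients_apply, coefficients_apply, fiberMk_smul, inner_smul_right]

theorem setOf_proj_eq (B : Set (TotalSpace K X)) (x : K) : {b : B | b.1.proj = x} =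
    Set.range fun ζ : fiberSet B x => (⟨⟨x, ζ.1⟩, ζ.2⟩ : B) := by
  ext b
  constructor
  · rintro rfl
    exact ⟨⟨b.1.vec, b.2⟩, rfl⟩
  · rintro ⟨ζ, rfl⟩
    rfl

theorem finite_setOf_proj_eq {B : Set (TotalSpace K X)} {x : K} (hB : (fiberSet B x).Finite) :
    {b : B | b.1.proj = x}.Finite := by
  have := hB.to_subtype
  rw [setOf_proj_eq]
  exact Set.finite_range _

/-- `B` lives in the larger of the universes of `K` and `X`, while the edge space must live in that
of `K`. -/
theorem small_of_finite_fiberSet {B : Set (TotalSpace K X)}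
    (hB : ∀ x, (fiberSet B x).Finite) : Small.{u} B := by
  have := fun x => (hB x).to_subtype
  have := fun x => Countable.toSmall.{u} (fiberSet B x)
  exact small_of_surjective (f := fun q : Σ x : K, fiberSet B x =>
    (⟨⟨q.1, q.2.1⟩, q.2.2⟩ : B)) fun b => ⟨⟨b.1.proj, b.1.vec, b.2⟩, rfl⟩

namespace IsContinuousChoiceOfBases

variable [T2Space K] {B : Set (TotalSpace K X)}

/-- Over a compact set inside the domain of a frame, `B` is the union of the images of that set
under the finitely many frame sections. Compactness of `K` glues finitely many such pieces. -/
theorem isCompact (hB : IsContinuousChoiceOfBases B) : IsCompact B := by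
  have h := (isCompact_univ (X := K)).induction_on
    (p := fun S => ∃ T ⊆ B, IsCompact T ∧ ∀ b ∈ B, b.proj ∈ S → b ∈ T)
    ⟨∅, by simp, isCompact_empty, by simp⟩
    (fun S S' hS ⟨T, hTB, hT, h⟩ => ⟨T, hTB, hT, fun b hb hbS => h b hb (hS hbS)⟩)
    (fun S S' ⟨T, hTB, hT, h⟩ ⟨T', hTB', hT', h'⟩ => ⟨T ∪ T', Set.union_subset hTB hTB',
      hT.union hT', fun b hb hbS => hbS.imp (h b hb) (h' b hb)⟩)
    (fun x _ => by
      obtain ⟨U, k, F, hU, hx, hF⟩ := hB.exists_frame x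
      obtain ⟨C, hC, hxC, hCU⟩ := exists_compact_subset hU hx
      refine ⟨C, mem_nhdsWithin_of_mem_nhds (mem_interior_iff_mem_nhds.mp hxC),
        ⋃ l, (fun x : U => TotalSpace.mk (x : K) (F.basis x l)) '' (Subtype.val ⁻¹' C),
        Set.iUnion_subset fun l => ?_, isCompact_iUnion fun l => ?_, fun b hb hbC => ?_⟩
      · rintro _ ⟨y, -, rfl⟩
        exact hF.mem y l
      · refine IsCompact.image ?_ (F.continuous_basis l)
        refine Topology.IsInducing.subtypeVal.isCompact_preimage_iff ?_ |>.mpr hC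
        simpa using hCU
      · obtain ⟨l, hl⟩ := hF.exists_eq hb (hCU hbC)
        refine Set.mem_iUnion.mpr ⟨l, ⟨b.proj, hCU hbC⟩, hbC, ?_⟩
        change TotalSpace.mk b.proj _ = TotalSpace.mk b.proj b.vec
        rw [hl])
  obtain ⟨T, hTB, hT, h⟩ := h
  rwa [hTB.antisymm fun b hb => h b hb trivial] at hT

/-- This is Parseval's identity in the fibre, indexed by the members of `B` over `x`. -/
theorem inner_fiberMk_eq_sum (hB : IsContinuousChoiceOfBases B) (v w : X) (x : K)
    {s : Finset B} (hs : ∀ b, b ∈ s ↔ b.1.proj = x) :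
    inner ℂ (fiberMk X x v) (fiberMk X x w) =
      ∑ b ∈ s, star (coefficients B v b) * coefficients B w b := by
  obtain ⟨U, k, F, hU, hx, hF⟩ := hB.exists_frame x
  rw [← (F.basis ⟨x, hx⟩).sum_inner_mul_inner]
  refine Finset.sum_bij (fun l _ => ⟨_, hF.mem ⟨x, hx⟩ l⟩) (fun l _ => (hs _).mpr rfl)
    (fun l _ m _ h => ?_) (fun b hb => ?_) fun l _ => ?_
  · simp only [Subtype.mk.injEq, TotalSpace.mk.injEq, heq_eq_eq, true_and] at h
    exact (F.basis ⟨x, hx⟩).orthonormal.linearIndependent.injective h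
  · obtain rfl := (hs b).mp hb
    obtain ⟨l, hl⟩ := hF.exists_eq b.2 hx
    refine ⟨l, Finset.mem_univ _, Subtype.ext ?_⟩
    change TotalSpace.mk b.1.proj _ = TotalSpace.mk b.1.proj b.1.vec
    rw [hl]
  · rw [coefficients_apply, coefficients_apply]
    congr 1
    exact (inner_conj_symm _ _).symm

theorem exists_norm_le (hB : IsContinuousChoiceOfBases B) [CompactSpace B] :
    ∃ N : NNReal, ∀ v : X, ‖v‖ ≤ N * ‖coefficients B v‖ := by
  obtain ⟨N, hN⟩ := hB.isLocallyConstant.range_finite.bddAbove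
  -- By Parseval, `⟨v, v⟩(x)` is a sum of at most `N` terms, each bounded by the squared supremum
  -- norm of the coefficients.
  refine ⟨NNReal.sqrt N, fun v => ?_⟩
  refine le_of_sq_le_sq ?_ (by positivity)
  rw [CStarModule.norm_sq_eq C(K, ℂ) (x := v), mul_pow, ← NNReal.coe_pow, NNReal.sq_sqrt]
  refine (ContinuousMap.norm_le _ (by positivity)).mpr fun x => ?_
  rw [← inner_fiberMk, hB.inner_fiberMk_eq_sum v v x
    (s := (finite_setOf_proj_eq (hB.finite x)).toFinset) (by simp)]
  refine (norm_sum_le_of_le _ (f := fun b => star (coefficients B v b) * coefficients B v b)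
    (n := fun _ => ‖coefficients B v‖ ^ 2) fun b _ => ?_).trans ?_
  · rw [norm_mul, norm_star, ← sq]
    gcongr
    exact (coefficients B v).norm_coe_le_norm b
  · rw [Finset.sum_const, nsmul_eq_mul]
    gcongr
    rw [NNReal.coe_natCast, Nat.cast_le]
    refine le_trans ?_ (hN (Set.mem_range_self x))
    rw [← Set.ncard_eq_toFinset_card _ (finite_setOf_proj_eq (hB.finite x))]
    rw [setOf_proj_eq, ← Set.image_univ, ← Nat.card_coe_set_eq (fiberSet B x), ← Set.ncard_univ]
    have := (hB.finite x).to_subtype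
    exact Set.ncard_image_le Set.finite_univ

theorem exists_coefficients_eq (hB : IsContinuousChoiceOfBases B) (f : C(B, ℂ)) (x : K) :
    ∃ v : X, ∀ b : B, b.1.proj = x → coefficients B v b = f b := by
  obtain ⟨U, k, F, hU, hx, hF⟩ := hB.exists_frame x
  obtain ⟨v, hv⟩ := fiberMk_surjective X x
    (∑ l, f ⟨_, hF.mem ⟨x, hx⟩ l⟩ • F.basis ⟨x, hx⟩ l)
  refine ⟨v, ?_⟩
  rintro ⟨b, hb⟩ rfl
  obtain ⟨l, hl⟩ := hF.exists_eq hb hx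
  rw [coefficients_apply]
  simp only
  rw [hv, ← hl, (F.basis ⟨b.proj, hx⟩).orthonormal.inner_right_fintype]
  congr 1
  refine Subtype.ext ?_
  change TotalSpace.mk b.proj _ = TotalSpace.mk b.proj b.vec
  rw [hl]

/-- Coefficients can be matched exactly over one point, hence up to `ε` over a neighbourhood of it.
A partition of unity on `K` combines these local solutions, since taking coefficients is
`C(K)`-linear. -/
theorem exists_norm_coefficients_sub_le [CompactSpace B] (hB : IsContinuousChoiceOfBases B)
    (f : C(B, ℂ)) {ε : ℝ} (hε : 0 < ε) : ∃ v : X, ‖coefficients B v - f‖ ≤ ε := by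
  choose v hv using hB.exists_coefficients_eq f
  -- `W x` is the set of points over which `v x` is within `ε` of `f` throughout the fibre of `B`.
  -- It is open because the projection from the compact space `B` is a closed map.
  let W : K → Set K := fun x =>
    ((fun b : B => b.1.proj) '' {b | ε ≤ ‖coefficients B (v x) b - f b‖})ᶜ
  have hW : ∀ x, IsOpen (W x) := fun x => by
    refine IsClosed.isOpen_compl (self := ?_)
    refine hB.isLocalHomeomorph.continuous.isClosedMap _ (isClosed_le continuous_const ?_)
    fun_prop
  have hxW : ∀ x, x ∈ W x := fun x ⟨b, hb, hbx⟩ => by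
    simp only [Set.mem_ofPred_eq, hv x b hbx, sub_self, norm_zero] at hb
    exact hε.not_ge hb
  have hWε : ∀ x (b : B), b.1.proj ∈ W x → ‖coefficients B (v x) b - f b‖ ≤ ε := fun x b hb =>
    le_of_lt (not_le.mp fun h => hb ⟨b, h, rfl⟩)
  obtain ⟨t, ht⟩ := isCompact_univ.elim_finite_subcover W hW
    fun x _ => Set.mem_iUnion.mpr ⟨x, hxW x⟩
  obtain ⟨ρ, hρW, hρ1, hρI, -⟩ := exists_continuous_sum_one_of_isOpen_isCompact
    (s := fun i => W (t.equivFin.symm i)) (fun i => hW _) isCompact_univ (fun x hx => by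
      obtain ⟨y, hy, hxy⟩ := Set.mem_iUnion₂.mp (ht hx)
      exact Set.mem_iUnion.mpr ⟨t.equivFin ⟨y, hy⟩, by simpa using hxy⟩)
  let a : Fin t.card → C(K, ℂ) := fun i => ⟨fun x => (ρ i x : ℂ), by fun_prop⟩
  refine ⟨∑ i, a i • v (t.equivFin.symm i), (ContinuousMap.norm_le _ hε.le).mpr fun b => ?_⟩
  have h1 : ∑ i, ρ i b.1.proj = 1 := by simpa using hρ1 (Set.mem_univ b.1.proj)
  have h2 : (coefficients B (∑ i, a i • v (t.equivFin.symm i)) - f) b =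
      ∑ i, (ρ i b.1.proj : ℂ) * (coefficients B (v (t.equivFin.symm i)) b - f b) := by
    simp only [mul_sub, Finset.sum_sub_distrib, ← Finset.sum_mul, ← Complex.ofReal_sum, h1,
      map_sum, ContinuousMap.sub_apply, ContinuousMap.sum_apply, coefficients_action]
    simp [a]
  rw [h2]
  refine (norm_sum_le_of_le _ (n := fun i => ρ i b.1.proj * ε) fun i _ => ?_).trans ?_
  · rw [norm_mul, Complex.norm_real, Real.norm_of_nonneg (hρI i _).1]
    by_cases h0 : ρ i b.1.proj = 0
    · simp [h0]
    · exact mul_le_mul_of_nonneg_left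
        (hWε _ _ (hρW i (subset_tsupport _ h0))) (hρI i _).1
  · rw [← Finset.sum_mul, h1, one_mul]

/-- The lower bound gives injectivity and, with `X` complete, a closed range; the approximation
lemma makes the range dense. -/
theorem bijective_coefficients [CompleteSpace X] (hB : IsContinuousChoiceOfBases B) :
    Function.Bijective (coefficients B) := by
  have : CompactSpace B := isCompact_iff_compactSpace.mp hB.isCompact
  obtain ⟨N, hN⟩ := hB.exists_norm_le
  have hanti : AntilipschitzWith N (coefficients B) :=
    AddMonoidHomClass.antilipschitz_of_bound _ hN
  have hunif : UniformContinuous (coefficients B) := by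
    refine AddMonoidHomClass.uniformContinuous_of_bound _ 1 fun v => ?_
    refine (ContinuousMap.norm_le _ (by positivity)).mpr fun b => ?_
    refine (norm_inner_le_norm b.1.vec (fiberMk X b.1.proj v)).trans ?_
    rw [(hB.orthonormal b.1.proj).1 ⟨b.1.vec, b.2⟩]
    gcongr
    exact norm_fiberMk_le v _
  refine ⟨hanti.injective, fun f => ?_⟩
  have hcl := hanti.isClosed_range hunif
  change f ∈ Set.range (coefficients B)
  rw [← hcl.closure_eq]
  refine Metric.mem_closure_iff.mpr fun ε hε => ?_
  obtain ⟨v, hv⟩ := hB.exists_norm_coefficients_sub_le f (half_pos hε)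
  refine ⟨_, Set.mem_range_self v, ?_⟩
  rw [dist_comm, dist_eq_norm]
  exact hv.trans_lt (half_lt_self hε)

theorem nonempty_iso [CompleteSpace X] (hB : IsContinuousChoiceOfBases B)
    (E : CompactTopologicalGraph.{u}) (h : E.Vertex ≃ₜ K) (H : B ≃ₜ E.Edge)
    (hH : ∀ b, h (E.source (H b)) = b.1.proj) : Nonempty (HilbertModuleIso h X E.GraphModule) := by
  let Φ : X →ₗ[ℂ] E.GraphModule :=
    { toFun := fun v => (coefficients B v).comp (H.symm : C(E.Edge, B))
      map_add' := fun v w => by rw [map_add]; rfl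
      map_smul' := fun c v => by rw [map_smul]; rfl }
  have hΦB : ∀ v b, (Φ v).toMap (H b) = coefficients B v b := fun v b =>
    congrArg (coefficients B v) (H.symm_apply_apply b)
  have hext : ∀ g g' : E.GraphModule, (∀ b, g.toMap (H b) = g'.toMap (H b)) → g = g' :=
    fun g g' hg => ContinuousMap.ext fun e => by
      obtain ⟨b, rfl⟩ := H.surjective e
      exact hg b
  have hΦ : Function.Bijective Φ := by
    refine ⟨fun v w hvw => hB.bijective_coefficients.1 (ContinuousMap.ext fun b => ?_),
      fun g => ?_⟩
    · rw [← hΦB, ← hΦB, hvw]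
    · obtain ⟨v, hv⟩ := hB.bijective_coefficients.2 (g.toMap.comp (H : C(B, E.Edge)))
      refine ⟨v, hext _ _ fun b => ?_⟩
      rw [hΦB, hv]
      rfl
  refine ⟨⟨LinearEquiv.ofBijective Φ hΦ, fun a v => hext _ _ fun b => ?_, fun v w => ?_⟩⟩
  · rw [CompactTopologicalGraph.GraphModule.action_toMap, LinearEquiv.ofBijective_apply,
      LinearEquiv.ofBijective_apply, hΦB, hΦB, coefficients_action, ← hH b, mul_comm]
    rfl
  · ext u
    change inner C(E.Vertex, ℂ) (Φ v) (Φ w) u = inner C(K, ℂ) v w (h u)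
    rw [← inner_fiberMk, hB.inner_fiberMk_eq_sum v w (h u)
      (s := (finite_setOf_proj_eq (hB.finite (h u))).toFinset) (by simp),
      CompactTopologicalGraph.GraphModule.inner_apply]
    symm
    refine Finset.sum_bij (fun b _ => H b) (fun b hb => ?_) (fun b _ b' _ hbb =>
      H.injective hbb) (fun e he => ?_) fun b _ => by rw [hΦB, hΦB]
    · simp only [Set.Finite.mem_toFinset, Set.mem_ofPred_eq, ← hH b] at hb
      simpa using h.injective hb
    · obtain ⟨b, rfl⟩ := H.surjective e
      refine ⟨b, ?_, rfl⟩
      simp only [Set.Finite.mem_toFinset, Set.mem_preimage, Set.mem_singleton_iff] at he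
      simp [← hH b, he]

theorem exists_graph_iso [CompleteSpace X] (hB : IsContinuousChoiceOfBases B) :
    ∃ (E : CompactTopologicalGraph.{u}) (h : E.Vertex ≃ₜ K),
      Nonempty (HilbertModuleIso h X E.GraphModule) := by
  have : CompactSpace B := isCompact_iff_compactSpace.mp hB.isCompact
  have : Small.{u} B := small_of_finite_fiberSet hB.finite
  let H : B ≃ₜ Shrink.{u} B := Shrink.homeomorph B
  have : CompactSpace (Shrink.{u} B) := H.compactSpace
  have : T2Space (Shrink.{u} B) := H.t2Space
  have hs := hB.isLocalHomeomorph.comp H.symm.isLocalHomeomorph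
  -- The graph module does not involve the range map, so the source map serves as range map too.
  let E : CompactTopologicalGraph.{u} := ⟨K, Shrink.{u} B, _, _, hs.continuous, hs⟩
  let h : E.Vertex ≃ₜ K := Homeomorph.refl K
  exact ⟨E, h, hB.nonempty_iso E h H fun b =>
    congrArg (fun b : B => b.1.proj) (H.symm_apply_apply b)⟩

end IsContinuousChoiceOfBases

end BasesToGraph

end CanonicalBundle

theorem mainTheorem6 (K : Type u) [TopologicalSpace K] [CompactSpace K] [T2Space K]
    [SecondCountableTopology K]
    (X : Type v) [NormedAddCommGroup X] [NormedSpace ℂ X] [CompleteSpace X]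
    [Module C(K, ℂ) X] [CStarModule C(K, ℂ) X] :
    List.TFAE [
      ∃ (E : CompactTopologicalGraph.{u}) (h : E.Vertex ≃ₜ K),
        Nonempty (HilbertModuleIso h X E.GraphModule),
      ∃ B : Set (CanonicalBundle.TotalSpace K X), CanonicalBundle.IsContinuousChoiceOfBases B,
      CanonicalBundle.HasFiniteRank K X ∧
        ∃ τ : CanonicalBundle.LocalTrivialisation K X, τ.IsPermutationValued,
      CanonicalBundle.HasFiniteRank K X ∧
        ∃ τ : CanonicalBundle.LocalTrivialisation K X, τ.IsUnitary ∧ τ.IsPermutationValued] := by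
  tfae_have 1 → 2 := fun ⟨E, h, ⟨Φ⟩⟩ =>
    CanonicalBundle.exists_isContinuousChoiceOfBases_of_iso E h Φ
  tfae_have 2 → 1 := fun ⟨_, hB⟩ => hB.exists_graph_iso
  tfae_have 2 → 4 := fun ⟨_, hB⟩ => ⟨hB.hasFiniteRank, hB.exists_localTrivialisation⟩
  tfae_have 4 → 3 := fun ⟨hr, τ, _, hτ⟩ => ⟨hr, τ, hτ⟩
  tfae_have 3 → 2 := fun ⟨_, τ, hτ⟩ =>
    CanonicalBundle.exists_isContinuousChoiceOfBases_of_localTrivialisation τ hτ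
  tfae_finish
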